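/- Let $\lambda$ be an (infinite) regular cardinal and let $\mathcal{A}$ be a small category which is $\lambda$-complete and $\lambda$-cocomplete, i.e. it has all limits and all colimits indexed by categories with fewer than $\lambda$ arrows. Assume that $\mathcal{A}$ is not a preorder, i.e. that some two objects of $\mathcal{A}$ have two distinct parallel arrows between them. Let $\mathsf{Ind}_\lambda\mathcal{A}\subseteq \mathsf{Set}^{\mathcal{A}^{\circ}}$ be the full subcategory of those presheaves that are colimits of small $\lambda$-filtered diagrams of representables, let $\mathsf{Pro}_\lambda\mathcal{A}=(\mathsf{Ind}_\lambda(\mathcal{A}^{\circ}))^{\circ}$, and let $i:\mathcal{A}\to\mathsf{Ind}_\lambda\mathcal{A}$ and $i^\sharp:\mathcal{A}\to\mathsf{Pro}_\lambda\mathcal{A}$ be the canonical inclusions (the Yoneda embedding of $\mathcal{A}$ and the opposite of the Yoneda embedding of $\mathcal{A}^\circ$). Then the following cannot happen simultaneously: 1. $i:\mathcal{A}\to\mathsf{Ind}_\lambda\mathcal{A}$ is codense, i.e. the identity functor of $\mathsf{Ind}_\lambda\mathcal{A}$, with the canonical $2$-cell, is a pointwise right Kan extension of $i$ along itself; 2.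 $i^\sharp:\mathcal{A}\to\mathsf{Pro}_\lambda\mathcal{A}$ is dense, i.e. the identity functor of $\mathsf{Pro}_\lambda\mathcal{A}$, with the canonical $2$-cell, is a pointwise left Kan extension of $i^\sharp$ along itself. -/

import Mathlib

universe w

namespace RestrictedIsbell

open CategoryTheory CategoryTheory.Limits Opposite

/-- `A` is `κ`-complete: it has all limits indexed by categories with fewer than `κ` arrows. -/
def IsCardinalComplete (A : Type w) [SmallCategory A] (κ : Cardinal.{w}) : Prop :=
  ∀ (J : Type w) [SmallCategory J], HasCardinalLT (Arrow J) κ → HasLimitsOfShape J A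

/-- `A` is `κ`-cocomplete: it has all colimits indexed by categories with fewer than `κ` arrows. -/
def IsCardinalCocomplete (A : Type w) [SmallCategory A] (κ : Cardinal.{w}) : Prop :=
  ∀ (J : Type w) [SmallCategory J], HasCardinalLT (Arrow J) κ → HasColimitsOfShape J A

/-- A presheaf on `A` is a `κ`-ind-object if it is the colimit of a small `κ`-filtered diagram
of representable presheaves. -/
def isCardinalIndObject (A : Type w) [SmallCategory A] (κ : Cardinal.{w}) [Fact κ.IsRegular] :
    ObjectProperty (Aᵒᵖ ⥤ Type w) :=
  fun P => ∃ (J : Type w) (_ : SmallCategory J) (_ : IsCardinalFiltered J κ) (F : J ⥤ A)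
    (ι : F ⋙ yoneda ⟶ (Functor.const J).obj P), Nonempty (IsColimit (Cocone.mk P ι))

/-- Representable presheaves are `κ`-ind-objects. -/
lemma isCardinalIndObject_yoneda (A : Type w) [SmallCategory A] (κ : Cardinal.{w})
    [Fact κ.IsRegular] (X : A) : isCardinalIndObject A κ (yoneda.obj X) :=
  ⟨Discrete PUnit.{w + 1}, inferInstance,
    ⟨fun _ _ => ⟨{ pt := ⟨PUnit.unit⟩, ι := { app := fun _ => eqToHom (Subsingleton.elim _ _) } }⟩⟩,
    Functor.fromPUnit X, { app := fun _ => 𝟙 _ },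
    ⟨{ desc := fun s => s.ι.app ⟨PUnit.unit⟩
       fac := fun s j => Category.id_comp _
       uniq := fun _ m h => (Category.id_comp m).symm.trans (h ⟨PUnit.unit⟩) }⟩⟩

/-- `Ind_κ A`, the full subcategory of `Set^(Aᵒᵖ)` on the `κ`-ind-objects. -/
abbrev IndCompletion (A : Type w) [SmallCategory A] (κ : Cardinal.{w}) [Fact κ.IsRegular] :
    Type (w + 1) :=
  (isCardinalIndObject A κ).FullSubcategory

/-- The canonical inclusion `i : A ⥤ Ind_κ A`, i.e. the corestricted Yoneda embedding. -/
def indInclusion (A : Type w) [SmallCategory A] (κ : Cardinal.{w}) [Fact κ.IsRegular] :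
    A ⥤ IndCompletion A κ :=
  (isCardinalIndObject A κ).lift yoneda (isCardinalIndObject_yoneda A κ)

/-- `Pro_κ A = (Ind_κ Aᵒᵖ)ᵒᵖ`. -/
abbrev ProCompletion (A : Type w) [SmallCategory A] (κ : Cardinal.{w}) [Fact κ.IsRegular] :
    Type (w + 1) :=
  (IndCompletion Aᵒᵖ κ)ᵒᵖ

/-- The canonical inclusion `i♯ : A ⥤ Pro_κ A`, i.e. the opposite of the canonical inclusion
`Aᵒᵖ ⥤ Ind_κ Aᵒᵖ`. -/
def proInclusion (A : Type w) [SmallCategory A] (κ : Cardinal.{w}) [Fact κ.IsRegular] :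
    A ⥤ ProCompletion A κ :=
  (indInclusion Aᵒᵖ κ).rightOp

/-- A functor `F : C ⥤ D` is codense if the identity of `D`, with the canonical 2-cell, is a
pointwise right Kan extension of `F` along itself. This is dual to `Functor.IsDense`. -/
def IsCodense {C D : Type*} [Category* C] [Category* D] (F : C ⥤ D) : Prop :=
  Nonempty ((Functor.RightExtension.mk (𝟭 D)
    (Functor.rightUnitor F).hom).IsPointwiseRightKanExtension)

end RestrictedIsbell

namespace RestrictedIsbell

open CategoryTheory CategoryTheory.Limits Opposite Filter

variable {A : Type w} [SmallCategory A]

/-! Let `d ≠ 𝟙 b` be idempotent and let `I` be `κ` with its well-order. The formal power `P = b ^ I`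
and its reduced power `K` modulo tails glue compatible families, hence are `κ`-ind-objects. Two maps
`P ⟶ K`, the diagonal and the sequence of truncations along `d`, are distinct but agree on truncated
families. Density of `i♯` forces every map from `P` to a representable to depend only on the
coordinates below some `α` (`exists_factorization_of_isDense`), and truncating at `α` leaves these
unchanged. So every map from `K` to a representable equalizes the two maps, whereas codensity of `i`
makes such maps jointly separating. -/

/-! ### Gluing, ind-objects and reduced powers -/

/-- Compatible families of elements of `P` over `κ`-small diagrams with a colimit can be glued. -/
def HasGluing (P : Aᵒᵖ ⥤ Type w) (κ : Cardinal.{w}) : Prop :=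
  ∀ (J : Type w) [SmallCategory J], HasCardinalLT (Arrow J) κ →
    ∀ (F : J ⥤ A) [HasColimit F] (s : ∀ j, P.obj (op (F.obj j))),
      (∀ ⦃j j' : J⦄ (u : j ⟶ j'), P.map (F.map u).op (s j') = s j) →
        ∃ t : P.obj (op (colimit F)), ∀ j, P.map (colimit.ι F j).op t = s j

/-- A glued element over the colimit of the underlying objects is the vertex of a cocone in the
category of elements. -/
lemma isCardinalFiltered_costructuredArrow_yoneda {κ : Cardinal.{w}} [Fact κ.IsRegular]
    (hcolim : IsCardinalCocomplete A κ) {P : Aᵒᵖ ⥤ Type w} (hP : HasGluing P κ) :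
    IsCardinalFiltered (CostructuredArrow yoneda P) κ where
  nonempty_cocone {J} _ F hJ := by
    have := hcolim J hJ
    obtain ⟨t, ht⟩ := hP J hJ (F ⋙ CostructuredArrow.proj yoneda P)
      (fun j => yonedaEquiv (F.obj j).hom) (fun j j' u => by
        have h := CostructuredArrow.w (F.map u)
        rw [← h]
        exact yonedaEquiv_naturality (F.obj j').hom (F.map u).left)
    refine ⟨⟨CostructuredArrow.mk (yonedaEquiv.symm t), ?_⟩⟩
    refine
      { app := fun j => CostructuredArrow.homMk
          (colimit.ι (F ⋙ CostructuredArrow.proj yoneda P) j) ?_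
        naturality := fun j j' u => ?_ }
    · apply yonedaEquiv.injective
      refine (yonedaEquiv_naturality (yonedaEquiv.symm t) _).symm.trans ?_
      rw [Equiv.apply_symm_apply]
      exact ht j
    · ext
      exact (colimit.w (F ⋙ CostructuredArrow.proj yoneda P) u).trans (Category.comp_id _).symm

lemma isCardinalIndObject_of_hasGluing {κ : Cardinal.{w}} [Fact κ.IsRegular]
    (hcolim : IsCardinalCocomplete A κ) {P : Aᵒᵖ ⥤ Type w} (hP : HasGluing P κ) :
    isCardinalIndObject A κ P :=
  ⟨CostructuredArrow yoneda P, inferInstance,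
    isCardinalFiltered_costructuredArrow_yoneda hcolim hP, CostructuredArrow.proj yoneda P,
    (Presheaf.tautologicalCocone P).ι, ⟨Presheaf.isColimitTautologicalCocone P⟩⟩

/-- The presheaf represented by the formal power `b ^ I`. -/
def powerPresheaf (I : Type w) (b : A) : Aᵒᵖ ⥤ Type w where
  obj x := I → (x.unop ⟶ b)
  map u := TypeCat.ofHom fun t i => u.unop ≫ t i

lemma hasGluing_powerPresheaf (I : Type w) (b : A) (κ : Cardinal.{w}) :
    HasGluing (powerPresheaf I b) κ := by
  intro J _ _ F _ s hs
  refine ⟨fun i => colimit.desc F ⟨b, { app := fun j => s j i, naturality := ?_ }⟩, fun j => ?_⟩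
  · intro j j' u
    exact (congrFun (hs u) i).trans (Category.comp_id _).symm
  · funext i
    exact colimit.ι_desc _ _

/-- The reduced power of a presheaf along the filter `atTop` on `I`. -/
def germPresheaf (I : Type w) [Preorder I] (P : Aᵒᵖ ⥤ Type w) : Aᵒᵖ ⥤ Type w where
  obj x := Germ (atTop : Filter I) (P.obj x)
  map u := TypeCat.ofHom (Germ.map (P.map u))
  map_id x := by
    ext y
    induction y using Germ.inductionOn
    simp [Germ.map_coe, Function.comp_def]
  map_comp u v := by
    ext y
    induction y using Germ.inductionOn
    simp [Germ.map_coe, Function.comp_def]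

/-- Each compatibility relation holds on a tail; there are fewer than `κ` of them, so they share a
tail, where gluing is done index by index. -/
lemma hasGluing_germPresheaf {κ : Cardinal.{w}} [Fact κ.IsRegular] (I : Type w) [LinearOrder I]
    [IsCardinalFiltered I κ] [Nonempty I] {P : Aᵒᵖ ⥤ Type w} (hP : HasGluing P κ) :
    HasGluing (germPresheaf I P) κ := by
  intro J _ hJ F _ s hs
  choose r hr using fun j => Quotient.exists_rep (s j)
  change ∀ j, ((r j : I → _) : Germ atTop (P.obj (op (F.obj j)))) = s j at hr
  have h : ∀ e : Arrow J, ∃ α : I, ∀ β, α ≤ β →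
      P.map (F.map e.hom).op (r e.right β) = r e.left β := fun e => by
    have := hs e.hom
    rw [← hr, ← hr] at this
    exact eventually_atTop.1 (Germ.coe_eq.1 this)
  choose α hα using h
  let γ := IsCardinalFiltered.max α hJ
  have hγ (e : Arrow J) : α e ≤ γ := leOfHom (IsCardinalFiltered.toMax α hJ e)
  -- Indices are pushed beyond `γ` so that `t` is defined everywhere; germs ignore the change.
  choose t ht using fun β => hP J hJ F (fun j => r j (β ⊔ γ))
    (fun j j' u => hα (Arrow.mk u) _ ((hγ _).trans le_sup_right))
  refine ⟨((t : I → _) : Germ atTop (P.obj (op (colimit F)))), fun j => ?_⟩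
  rw [← hr]
  refine Germ.coe_eq.2 (eventually_atTop.2 ⟨γ, fun β hβ => ?_⟩)
  simp [ht, sup_eq_left.2 hβ]

/-! ### Consequences of codensity and density -/

lemma IsCodense.hom_ext {C D : Type*} [Category* C] [Category* D] {F : C ⥤ D} (h : IsCodense F)
    {X Y : D} {u v : X ⟶ Y} (huv : ∀ (c : C) (m : Y ⟶ F.obj c), u ≫ m = v ≫ m) : u = v :=
  (h.some Y).hom_ext fun j => by
    change u ≫ j.hom ≫ 𝟙 _ = v ≫ j.hom ≫ 𝟙 _
    rw [Category.comp_id]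
    exact huv _ j.hom

lemma exists_hom_of_isDense {κ : Cardinal.{w}} [Fact κ.IsRegular]
    [(proInclusion A κ).IsDense] (Q : IndCompletion Aᵒᵖ κ) (c : A)
    (s : ∀ x : A, (Q.obj ⟶ yoneda.obj (op x)) → (x ⟶ c))
    (hs : ∀ ⦃x y : A⦄ (u : x ⟶ y) (τ : Q.obj ⟶ yoneda.obj (op y)),
      s x (τ ≫ yoneda.map u.op) = u ≫ s y τ) :
    ∃ d : yoneda.obj (op c) ⟶ Q.obj, ∀ (x : A) (τ : Q.obj ⟶ yoneda.obj (op x)),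
      d ≫ τ = yoneda.map (s x τ).op := by
  let t : Cocone (CostructuredArrow.proj (proInclusion A κ) (op Q) ⋙ proInclusion A κ) :=
    { pt := (proInclusion A κ).obj c
      ι :=
        { app := fun X => (proInclusion A κ).map (s X.left X.hom.unop.hom)
          naturality := fun X Y u => by
            refine ((proInclusion A κ).map_comp u.left (s Y.left Y.hom.unop.hom)).symm.trans ?_
            refine Eq.trans ?_ (Category.comp_id _).symm
            exact congrArg (proInclusion A κ).map ((hs u.left Y.hom.unop.hom).symm.trans
              (congrArg (s X.left) (congrArg (fun m => m.unop.hom) (CostructuredArrow.w u)))) } }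
  let d := ((proInclusion A κ).denseAt (op Q)).desc t
  refine ⟨d.unop.hom, fun x τ => ?_⟩
  let v : (proInclusion A κ).obj x ⟶ op Q := Quiver.Hom.op (ObjectProperty.homMk τ)
  have h : (𝟙 _ ≫ v) ≫ d = (proInclusion A κ).map (s x τ) :=
    ((proInclusion A κ).denseAt (op Q)).fac t (CostructuredArrow.mk v)
  rw [Category.id_comp] at h
  exact congrArg (fun m => m.unop.hom) h

/-! ### The formal power as a pro-object -/

section

variable (I : Type w) [LinearOrder I] (b : A) [∀ α : I, HasProduct fun _ : Set.Iic α => b]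

/-- The partial powers `b ^ {i | i ≤ α}`, with the projections between them. -/
noncomputable def partialPowers : I ⥤ Aᵒᵖ where
  obj α := op (∏ᶜ fun _ : Set.Iic α => b)
  map {α β} u := (Pi.lift fun i : Set.Iic α =>
    Pi.π (fun _ : Set.Iic β => b) ⟨i.1, i.2.trans (leOfHom u)⟩).op
  map_id α := Quiver.Hom.unop_inj (Pi.hom_ext _ _ fun i => by simp)
  map_comp u v := Quiver.Hom.unop_inj (Pi.hom_ext _ _ fun i => by simp)

variable {I b}

/-- The map to a partial power given by the restriction of a family. -/
noncomputable def partialLift (α : I) {x : A} (t : I → (x ⟶ b)) :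
    x ⟶ ∏ᶜ fun _ : Set.Iic α => b :=
  Pi.lift fun i => t i

lemma partialLift_map {α β : I} (u : α ⟶ β) {x : A} (t : I → (x ⟶ b)) :
    partialLift β t ≫ ((partialPowers I b).map u).unop = partialLift α t :=
  Pi.hom_ext _ _ fun i => by simp [partialLift, partialPowers]

variable (I b)

/-- The formal `κ`-cofiltered limit of the partial powers. -/
noncomputable def proPower (κ : Cardinal.{w}) [Fact κ.IsRegular] [IsCardinalFiltered I κ] :
    IndCompletion Aᵒᵖ κ where
  obj := colimit (partialPowers I b ⋙ yoneda)
  property := ⟨I, inferInstance, inferInstance, partialPowers I b,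
    (colimit.cocone (partialPowers I b ⋙ yoneda)).ι, ⟨colimit.isColimit _⟩⟩

variable {I b}

/-- The map out of `proPower` corresponding to a family `t`. -/
noncomputable def proPowerDesc {x : A} (t : I → (x ⟶ b)) :
    colimit (partialPowers I b ⋙ yoneda) ⟶ yoneda.obj (op x) :=
  colimit.desc (partialPowers I b ⋙ yoneda) ⟨yoneda.obj (op x),
    { app := fun α => yoneda.map (partialLift α t).op
      naturality := fun α β u => by
        refine (yoneda.map_comp _ _).symm.trans (Eq.trans ?_ (Category.comp_id _).symm)
        exact congrArg (fun m => yoneda.map (Quiver.Hom.op m)) (partialLift_map u t) }⟩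

lemma ι_proPowerDesc {x : A} (t : I → (x ⟶ b)) (α : I) :
    colimit.ι (partialPowers I b ⋙ yoneda) α ≫ proPowerDesc t =
      yoneda.map (partialLift α t).op :=
  colimit.ι_desc (F := partialPowers I b ⋙ yoneda) _ _

/-- The family corresponding to a map out of `proPower`. -/
noncomputable def familyOfHom {x : A}
    (τ : colimit (partialPowers I b ⋙ yoneda) ⟶ yoneda.obj (op x)) (i : I) : x ⟶ b :=
  (yoneda.preimage (colimit.ι (partialPowers I b ⋙ yoneda) i ≫ τ)).unop ≫
    Pi.π (fun _ : Set.Iic i => b) ⟨i, le_rfl⟩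

lemma familyOfHom_comp {x y : A} (u : x ⟶ y)
    (τ : colimit (partialPowers I b ⋙ yoneda) ⟶ yoneda.obj (op y)) (i : I) :
    familyOfHom (τ ≫ yoneda.map u.op) i = u ≫ familyOfHom τ i := by
  have : yoneda.preimage (colimit.ι (partialPowers I b ⋙ yoneda) i ≫ τ ≫ yoneda.map u.op) =
      yoneda.preimage (colimit.ι (partialPowers I b ⋙ yoneda) i ≫ τ) ≫ u.op :=
    yoneda.map_injective (by simp)
  exact (congrArg (fun m => m.unop ≫ _) this).trans (Category.assoc _ _ _)

lemma familyOfHom_proPowerDesc {x : A} (t : I → (x ⟶ b)) :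
    familyOfHom (proPowerDesc t) = t := by
  funext i
  have h : yoneda.preimage (colimit.ι (partialPowers I b ⋙ yoneda) i ≫ proPowerDesc t) =
      (partialLift i t).op :=
    yoneda.map_injective ((yoneda.map_preimage _).trans (ι_proPowerDesc t i))
  refine (congrArg (fun m => m.unop ≫ _) h).trans ?_
  exact Pi.lift_π (f := fun _ : Set.Iic i => b) (fun j => t j) ⟨i, le_rfl⟩

/-- Families `I → (x ⟶ b)` come from the maps `x ⟶ proPower` in `Pro`, so `φ` gives a cocone on the
canonical diagram. Density turns it into a map `proPower ⟶ c`, which is an element of a colimit of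
hom-sets and so comes from one stage `α`. -/
lemma exists_factorization_of_isDense {κ : Cardinal.{w}} [Fact κ.IsRegular]
    [IsCardinalFiltered I κ] [h : (proInclusion A κ).IsDense] {c : A}
    (φ : powerPresheaf I b ⟶ yoneda.obj c) :
    ∃ (α : I) (h : (∏ᶜ fun _ : Set.Iic α => b) ⟶ c),
      ∀ (x : A) (t : I → (x ⟶ b)), φ.app (op x) t = partialLift α t ≫ h := by
  obtain ⟨d, hd⟩ := exists_hom_of_isDense (proPower I b κ) c
    (fun x τ => φ.app (op x) (familyOfHom τ)) (fun x y u τ => by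
      have : familyOfHom (τ ≫ yoneda.map u.op) = (powerPresheaf I b).map u.op (familyOfHom τ) :=
        funext fun i => familyOfHom_comp u τ i
      refine (congrArg (φ.app (op x)) this).trans ?_
      exact NatTrans.naturality_apply φ u.op (familyOfHom τ))
  change _ ⟶ colimit (partialPowers I b ⋙ yoneda) at d
  obtain ⟨α, h, hh⟩ := Types.jointly_surjective_of_isColimit
    (isColimitOfPreserves ((evaluation _ _).obj (op (op c)))
      (colimit.isColimit (partialPowers I b ⋙ yoneda))) (yonedaEquiv d)
  change (op c ⟶ (partialPowers I b).obj α) at h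
  have hd' : d = yoneda.map h ≫ colimit.ι (partialPowers I b ⋙ yoneda) α := by
    apply yonedaEquiv.injective
    rw [← hh, yonedaEquiv_comp, yonedaEquiv_yoneda_map]
    rfl
  refine ⟨α, h.unop, fun x t => ?_⟩
  have hdt : d ≫ proPowerDesc t = _ := hd x (proPowerDesc t)
  rw [familyOfHom_proPowerDesc, hd', Category.assoc, ι_proPowerDesc] at hdt
  exact (Quiver.Hom.op_inj (yoneda.map_injective ((yoneda.map_comp _ _).trans hdt))).symm

end

/-! ### Two maps into the reduced power -/

section

variable (I : Type w) [LinearOrder I] {b : A}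

/-- The diagonal map to the reduced power. -/
def constGerm (P : Aᵒᵖ ⥤ Type w) : P ⟶ germPresheaf I P where
  app x := TypeCat.ofHom fun t => Germ.ofFun fun _ => t

open Classical in
/-- Replace the coordinates of a family that are not below `α` by the image under `d` of the
`α`-th one. -/
noncomputable def truncate {I : Type w} [LinearOrder I] (d : b ⟶ b) {x : A} (α : I)
    (t : I → (x ⟶ b)) (i : I) : x ⟶ b :=
  if i ≤ α then t i else t α ≫ d

/-- The map to the reduced power given by the sequence of truncations of a family. -/
noncomputable def truncateGerm (d : b ⟶ b) :
    powerPresheaf I b ⟶ germPresheaf I (powerPresheaf I b) where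
  app x := TypeCat.ofHom fun t => Germ.ofFun fun α => truncate d α t
  naturality x y u := by
    ext t
    refine congrArg Germ.ofFun ?_
    funext α i
    change truncate d α (fun i => u.unop ≫ t i) i = u.unop ≫ truncate d α t i
    unfold truncate
    split_ifs <;> simp

variable {I}

lemma constGerm_app_eq_iff [Nonempty I] (d : b ⟶ b) {x : A} (t : I → (x ⟶ b)) :
    (constGerm I (powerPresheaf I b)).app (op x) t = (truncateGerm I d).app (op x) t ↔
      ∃ α : I, ∀ β, α ≤ β → t = truncate d β t :=
  Germ.coe_eq.trans eventually_atTop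

lemma constGerm_ne_truncateGerm [Nonempty I] [NoMaxOrder I] {d : b ⟶ b} (hd : d ≠ 𝟙 b) :
    constGerm I (powerPresheaf I b) ≠ truncateGerm I d := by
  intro h
  have h1 := congrArg (fun m => m.app (op b) (fun _ => 𝟙 b)) h
  obtain ⟨α, hα⟩ := (constGerm_app_eq_iff d _).1 h1
  obtain ⟨i, hi⟩ := exists_gt α
  have h2 : 𝟙 b = truncate d α (fun _ => 𝟙 b) i := congrFun (hα α le_rfl) i
  rw [truncate, if_neg hi.not_ge, Category.id_comp] at h2
  exact hd h2.symm

/-- Beyond `α` every coordinate is already `t α ≫ d`, so a later truncation changes nothing, by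
idempotence. -/
lemma constGerm_app_truncate [Nonempty I] {d : b ⟶ b} (hd : d ≫ d = d) {x : A} (α : I)
    (t : I → (x ⟶ b)) :
    (constGerm I (powerPresheaf I b)).app (op x) (truncate d α t) =
      (truncateGerm I d).app (op x) (truncate d α t) := by
  refine (constGerm_app_eq_iff d _).2 ⟨α, fun β hβ => ?_⟩
  funext i
  change truncate d α t i = truncate d β (truncate d α t) i
  by_cases h : i ≤ β
  · exact (if_pos h).symm
  · have hα : ¬ i ≤ α := fun h' => h (h'.trans hβ)
    simp only [truncate, if_neg h, if_neg hα]
    split_ifs with h'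
    · rw [le_antisymm h' hβ]
    · simp [hd]

lemma partialLift_truncate [∀ α : I, HasProduct fun _ : Set.Iic α => b] (d : b ⟶ b) {x : A}
    (α : I) (t : I → (x ⟶ b)) : partialLift α (truncate d α t) = partialLift α t :=
  Pi.hom_ext _ _ fun i => by
    simp [partialLift, truncate, Set.mem_Iic.1 i.2]

/-- The identity of a partial power, extended arbitrarily to a family. -/
lemma exists_partialLift_eq_id [∀ α : I, HasProduct fun _ : Set.Iic α => b] (α : I) :
    ∃ t : I → ((∏ᶜ fun _ : Set.Iic α => b) ⟶ b), partialLift α t = 𝟙 _ := by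
  classical
  refine ⟨fun i => if h : i ≤ α then Pi.π (fun _ : Set.Iic α => b) ⟨i, h⟩ else
    Pi.π (fun _ : Set.Iic α => b) ⟨α, le_rfl⟩, Pi.hom_ext _ _ fun i => ?_⟩
  simp [partialLift, Set.mem_Iic.1 i.2]

/-- Over a linear order whose initial segments have powers in `A`, a nontrivial idempotent
prevents codensity and density from holding at the same time. -/
lemma not_isCodense_and_isDense_of_idempotent {κ : Cardinal.{w}} [Fact κ.IsRegular]
    (hcolim : IsCardinalCocomplete A κ) (I : Type w) [LinearOrder I] [Nonempty I] [NoMaxOrder I]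
    [IsCardinalFiltered I κ] [∀ α : I, HasProduct fun _ : Set.Iic α => b]
    {d : b ⟶ b} (hd : d ≫ d = d) (hd' : d ≠ 𝟙 b) :
    ¬ (IsCodense (indInclusion A κ) ∧ (proInclusion A κ).IsDense) := by
  rintro ⟨hco, _⟩
  let P : IndCompletion A κ := ⟨powerPresheaf I b,
    isCardinalIndObject_of_hasGluing hcolim (hasGluing_powerPresheaf I b κ)⟩
  let K : IndCompletion A κ := ⟨germPresheaf I (powerPresheaf I b),
    isCardinalIndObject_of_hasGluing hcolim
      (hasGluing_germPresheaf I (hasGluing_powerPresheaf I b κ))⟩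
  let k₁ : P ⟶ K := ObjectProperty.homMk (constGerm I _)
  let k₂ : P ⟶ K := ObjectProperty.homMk (truncateGerm I d)
  refine constGerm_ne_truncateGerm (I := I) hd' (congrArg (fun m => m.hom) (?_ : k₁ = k₂))
  refine hco.hom_ext fun c m => ObjectProperty.hom_ext _ ?_
  let φ₁ : powerPresheaf I b ⟶ yoneda.obj c := constGerm I _ ≫ m.hom
  let φ₂ : powerPresheaf I b ⟶ yoneda.obj c := truncateGerm I d ≫ m.hom
  change φ₁ = φ₂
  obtain ⟨α₁, h₁, hφ₁⟩ := exists_factorization_of_isDense (κ := κ) φ₁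
  obtain ⟨α₂, h₂, hφ₂⟩ := exists_factorization_of_isDense (κ := κ) φ₂
  let α := α₁ ⊔ α₂
  let r₁ := ((partialPowers I b).map (homOfLE (le_sup_left : α₁ ≤ α))).unop
  let r₂ := ((partialPowers I b).map (homOfLE (le_sup_right : α₂ ≤ α))).unop
  have e₁ (x : A) (t : I → (x ⟶ b)) : φ₁.app (op x) t = partialLift α t ≫ r₁ ≫ h₁ := by
    rw [hφ₁, ← partialLift_map (homOfLE (le_sup_left : α₁ ≤ α))]
    exact Category.assoc _ _ _
  have e₂ (x : A) (t : I → (x ⟶ b)) : φ₂.app (op x) t = partialLift α t ≫ r₂ ≫ h₂ := by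
    rw [hφ₂, ← partialLift_map (homOfLE (le_sup_right : α₂ ≤ α))]
    exact Category.assoc _ _ _
  -- The generic family: evaluating at its truncation compares the two factorizations themselves.
  obtain ⟨t, ht⟩ := exists_partialLift_eq_id (b := b) α
  have h : φ₁.app _ (truncate d α t) = φ₂.app _ (truncate d α t) :=
    congrArg (m.hom.app (op (∏ᶜ fun _ : Set.Iic α => b))) (constGerm_app_truncate hd α t)
  rw [e₁, e₂, partialLift_truncate, ht] at h
  have hr : r₁ ≫ h₁ = r₂ ≫ h₂ :=
    (Category.id_comp _).symm.trans (h.trans (Category.id_comp _))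
  ext x s
  exact (e₁ x.unop s).trans ((congrArg (partialLift α s ≫ ·) hr).trans (e₂ x.unop s).symm)

end

/-! ### The idempotent and the index order -/

lemma exists_nontrivial_idempotent [HasBinaryProducts A] (h : ¬ Quiver.IsThin A) :
    ∃ (b : A) (d : b ⟶ b), d ≫ d = d ∧ d ≠ 𝟙 b := by
  obtain ⟨x, y, f, g, hfg⟩ : ∃ (x y : A) (f g : x ⟶ y), f ≠ g := by
    by_contra! h'
    exact h fun x y => ⟨h' x y⟩
  -- Retraction onto the graph of `f`; were it the identity, the graph of `g` would give `f = g`.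
  refine ⟨x ⨯ y, prod.lift prod.fst (prod.fst ≫ f), by
    ext <;> simp [prod.lift_fst, prod.lift_snd, prod.lift_fst_assoc], fun hd => hfg ?_⟩
  simpa [prod.lift_fst, prod.lift_snd, prod.lift_fst_assoc] using
    congrArg (fun m => prod.lift (𝟙 x) g ≫ m ≫ prod.snd) hd

lemma IsCardinalComplete.hasLimitsOfShape_discrete {κ : Cardinal.{w}}
    (h : IsCardinalComplete A κ) (T : Type w) (hT : HasCardinalLT T κ) :
    HasLimitsOfShape (Discrete T) A :=
  h (Discrete T) (by simpa using hT)

lemma IsCardinalComplete.hasBinaryProducts {κ : Cardinal.{w}} [Fact κ.IsRegular]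
    (h : IsCardinalComplete A κ) : HasBinaryProducts A := by
  have := h.hasLimitsOfShape_discrete (ULift.{w} WalkingPair)
    ((hasCardinalLT_of_finite _ _ le_rfl).of_le (Fact.out : κ.IsRegular).aleph0_le)
  exact hasLimitsOfShape_of_equivalence (Discrete.equivalence Equiv.ulift)

lemma hasCardinalLT_Iic_ord_toType {κ : Cardinal.{w}} [Fact κ.IsRegular] [NoMaxOrder κ.ord.ToType]
    (α : κ.ord.ToType) : HasCardinalLT (Set.Iic α) κ := by
  obtain ⟨β, hβ⟩ := exists_gt α
  rw [hasCardinalLT_iff_cardinal_mk_lt]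
  refine (Cardinal.mk_le_mk_of_subset fun i hi => lt_of_le_of_lt hi hβ).trans_lt
    (?_ : Cardinal.mk (Set.Iio β) < κ)
  simpa using Cardinal.mk_Iio_lt β

end RestrictedIsbell

theorem corollary2 (A : Type w) [CategoryTheory.SmallCategory A]
    (κ : Cardinal.{w}) [Fact κ.IsRegular]
    (hlim : RestrictedIsbell.IsCardinalComplete A κ)
    (hcolim : RestrictedIsbell.IsCardinalCocomplete A κ)
    (hthin : ¬ Quiver.IsThin A) :
    ¬ (RestrictedIsbell.IsCodense (RestrictedIsbell.indInclusion A κ) ∧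
      (RestrictedIsbell.proInclusion A κ).IsDense) := by
  have := hlim.hasBinaryProducts
  have hκ := (Fact.out : κ.IsRegular).aleph0_le
  have : NoMaxOrder κ.ord.ToType := Cardinal.noMaxOrder hκ
  have : Nonempty κ.ord.ToType := by
    rw [Ordinal.nonempty_toType_iff, ne_eq, Cardinal.ord_eq_zero]
    exact (Fact.out : κ.IsRegular).ne_zero
  have (α : κ.ord.ToType) := hlim.hasLimitsOfShape_discrete _ (RestrictedIsbell.hasCardinalLT_Iic_ord_toType α)
  obtain ⟨b, d, hd, hd'⟩ := RestrictedIsbell.exists_nontrivial_idempotent hthin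
  exact RestrictedIsbell.not_isCodense_and_isDense_of_idempotent hcolim κ.ord.ToType hd hd'
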